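/- Let $\alpha\in(0,1)$ and let $\xi$ be a real random variable with a symmetric distribution ($\xi$ and $-\xi$ have the same law) such that $\mathbb{P}\{\xi^2>t\}\sim t^{-\alpha}$ as $t\to\infty$, i.e. $t^{\alpha}\,\mathbb{P}\{\xi^2>t\}\to 1$. Let $(\xi_{i,j})_{i,j\in\mathbb{N}}$ be an array of independent copies of $\xi$ and, for $d,i\in\mathbb{N}$, put $$X_i^{(d)}:=d^{-1/(2\alpha)}(\xi_{i,1},\dots,\xi_{i,d})\in\mathbb{R}^d .$$ Let $\|\cdot\|_2$ and $\langle\cdot,\cdot\rangle_2$ be the Euclidean norm and inner product on $\mathbb{R}^d$, let $\Theta_i^{(d)}:=X_i^{(d)}/\|X_i^{(d)}\|_2$ (when $X_i^{(d)}\neq 0$), and let $a(k):=k^{1/\alpha}$ for $k\in\mathbb{N}$. Let $n=n(d)$ be an arbitrary sequence of positive integers such that $n(d)\to\infty$ as $d\to\infty$. Then, for every fixed $s>0$ and $\varepsilon>0$, the event $\{\|X_1^{(d)}\|_2^2\ge s\,a(n),\ \|X_2^{(d)}\|_2^2\ge s\,a(n)\}$ has positive probability for all sufficiently large $d$, and $$\lim_{d\to\infty}\mathbb{P}\left\{\left|\left\langle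 \Theta^{(d)}_1,\Theta^{(d)}_2\right\rangle_2\right|>\varepsilon\;\Big|\; \|X_1^{(d)}\|_2^2\ge s\,a(n),\ \|X_2^{(d)}\|_2^2\ge s\,a(n)\right\}=0 .$$ -/

import Mathlib

open MeasureTheory ProbabilityTheory Filter Topology Asymptotics

noncomputable section

/-- The angular component `x / ‖x‖₂` of a vector in `ℝ^d` (it is only evaluated at nonzero
vectors: the conditioning events below force the norms to be positive). -/
def angularPart {d : ℕ} (x : EuclideanSpace ℝ (Fin d)) : EuclideanSpace ℝ (Fin d) :=
  ‖x‖⁻¹ • x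

/-- The conditioning event `{‖X₁‖₂² ≥ c, ‖X₂‖₂² ≥ c}`. -/
def largeNormsEvent {Ω : Type*} {d : ℕ} (X₁ X₂ : Ω → EuclideanSpace ℝ (Fin d)) (c : ℝ) : Set Ω :=
  {ω | c ≤ ‖X₁ ω‖ ^ 2 ∧ c ≤ ‖X₂ ω‖ ^ 2}

/-- The asymptotic-orthogonality condition: `X d i` is the step number `i` (counted from `0`) of
the random walk in `ℝ^d`, `a` is the norming sequence and `n = n(d)`. For all fixed `s, ε > 0`,
`P(|⟨Θ₁, Θ₂⟩| > ε ∣ ‖X₁‖² ≥ s a(n), ‖X₂‖² ≥ s a(n)) → 0` as `d → ∞`, where the conditioning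
events are required to have positive probability for large `d`, so that the conditional
probabilities make sense. -/
def AsymptoticallyOrthogonal {Ω : Type*} [MeasurableSpace Ω] (P : Measure Ω)
    (X : (d : ℕ) → ℕ → Ω → EuclideanSpace ℝ (Fin d)) (a : ℕ → ℝ) (n : ℕ → ℕ) : Prop :=
  ∀ s : ℝ, 0 < s → ∀ ε : ℝ, 0 < ε →
    (∀ᶠ d in atTop, 0 < P (largeNormsEvent (X d 0) (X d 1) (s * a (n d)))) ∧
    Tendsto
      (fun d : ℕ =>
        (ProbabilityTheory.cond P (largeNormsEvent (X d 0) (X d 1) (s * a (n d))))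
          {ω | ε < |inner ℝ (angularPart (X d 0 ω)) (angularPart (X d 1 ω))|})
      atTop (𝓝 0)

/-- The step `X_i^{(d)} = d^{-1/(2α)} (ξ_{i,1}, …, ξ_{i,d})` (rows and columns counted
from `0`). -/
def heavyTailedStep {Ω : Type*} (α : ℝ) (ξ : ℕ → ℕ → Ω → ℝ) (d i : ℕ) (ω : Ω) :
    EuclideanSpace ℝ (Fin d) :=
  WithLp.toLp 2 (fun j : Fin d => (d : ℝ) ^ (-(1 / (2 * α))) * ξ i (j : ℕ) ω)

end

/-! The law of a step is invariant under sign changes and permutations of the coordinates, and so is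
the norm. Hence the matrix `E[Θ_j Θ_k; ‖X‖² ≥ c]` is scalar: sign changes kill the off-diagonal
entries, permutations equalise the diagonal ones, and the trace is at most `P(‖X‖² ≥ c)`, so each
diagonal entry is at most `P(‖X‖² ≥ c) / d`.

For independent steps, `E[⟨Θ₁, Θ₂⟩²; A]`, with `A` the conditioning event, is the sum of the
entrywise products of the two matrices, hence at most `d · P(A) / d² = P(A) / d`. Markov's
inequality bounds the conditional probability by `1 / (ε² d)`, uniformly in the threshold `c`
(`cond_largeNormsEvent_le`). The tail assumption serves to make `P(A)` positive. -/

/-- Reversal of the sign of the coordinate `j`. -/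
def signFlip {ι : Type*} [DecidableEq ι] (j : ι) (x : EuclideanSpace ℝ ι) : EuclideanSpace ℝ ι :=
  WithLp.toLp 2 (fun i => if i = j then -x i else x i)

/-- Permutation of the coordinates. -/
def coordPerm {ι : Type*} (σ : Equiv.Perm ι) (x : EuclideanSpace ℝ ι) : EuclideanSpace ℝ ι :=
  WithLp.toLp 2 (fun i => x (σ i))

/-- A measure on `ℝ^ι` that is invariant under sign changes and permutations of the
coordinates. -/
structure HyperoctahedralInvariant {ι : Type*} [DecidableEq ι]
    (ν : Measure (EuclideanSpace ℝ ι)) : Prop where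
  signFlip : ∀ j, MeasurePreserving (signFlip j) ν ν
  coordPerm : ∀ σ : Equiv.Perm ι, MeasurePreserving (coordPerm σ) ν ν

theorem norm_signFlip {ι : Type*} [Fintype ι] [DecidableEq ι] (j : ι) (x : EuclideanSpace ℝ ι) :
    ‖signFlip j x‖ = ‖x‖ := by
  simp only [EuclideanSpace.norm_eq, signFlip]
  congr 1
  refine Finset.sum_congr rfl fun i _ => ?_
  split_ifs <;> simp

theorem norm_coordPerm {ι : Type*} [Fintype ι] (σ : Equiv.Perm ι) (x : EuclideanSpace ℝ ι) :
    ‖coordPerm σ x‖ = ‖x‖ := by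
  simp only [EuclideanSpace.norm_eq, coordPerm]
  congr 1
  exact Equiv.sum_comp σ fun i => ‖x i‖ ^ 2

/-- The product of the coordinates `j` and `k` of the angular part, restricted to the vectors
with squared norm at least `c`. -/
noncomputable def truncatedAngularProduct {d : ℕ} (c : ℝ) (j k : Fin d) (x : EuclideanSpace ℝ (Fin d)) : ℝ :=
  {x | c ≤ ‖x‖ ^ 2}.indicator (fun x => angularPart x j * angularPart x k) x

theorem measurable_angularPart {d : ℕ} :
    Measurable (angularPart : EuclideanSpace ℝ (Fin d) → EuclideanSpace ℝ (Fin d)) := by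
  unfold angularPart
  fun_prop

theorem measurableSet_le_norm_sq {d : ℕ} (c : ℝ) :
    MeasurableSet {x : EuclideanSpace ℝ (Fin d) | c ≤ ‖x‖ ^ 2} :=
  measurableSet_le measurable_const (by fun_prop)

theorem measurable_angularPart_apply {d : ℕ} (j : Fin d) :
    Measurable fun x : EuclideanSpace ℝ (Fin d) => angularPart x j :=
  (EuclideanSpace.proj (𝕜 := ℝ) j).measurable.comp measurable_angularPart

theorem measurable_truncatedAngularProduct {d : ℕ} (c : ℝ) (j k : Fin d) :
    Measurable (truncatedAngularProduct c j k) :=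
  ((measurable_angularPart_apply j).mul (measurable_angularPart_apply k)).indicator
    (measurableSet_le_norm_sq c)

theorem norm_angularPart_le_one {d : ℕ} (x : EuclideanSpace ℝ (Fin d)) :
    ‖angularPart x‖ ≤ 1 := by
  rw [angularPart, norm_smul, norm_inv, norm_norm]
  exact inv_mul_le_one

theorem abs_truncatedAngularProduct_le_one {d : ℕ} (c : ℝ) (j k : Fin d)
    (x : EuclideanSpace ℝ (Fin d)) : |truncatedAngularProduct c j k x| ≤ 1 := by
  have h (i : Fin d) : |angularPart x i| ≤ 1 :=
    (PiLp.norm_apply_le (angularPart x) i).trans (norm_angularPart_le_one x)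
  unfold truncatedAngularProduct Set.indicator
  split_ifs
  · rw [abs_mul]
    exact mul_le_one₀ (h j) (abs_nonneg _) (h k)
  · simp

theorem integrable_truncatedAngularProduct {d : ℕ} (ν : Measure (EuclideanSpace ℝ (Fin d)))
    [IsFiniteMeasure ν] (c : ℝ) (j k : Fin d) : Integrable (truncatedAngularProduct c j k) ν :=
  .of_bound (measurable_truncatedAngularProduct c j k).aestronglyMeasurable 1
    (.of_forall fun x => abs_truncatedAngularProduct_le_one c j k x)

theorem truncatedAngularProduct_signFlip {d : ℕ} (c : ℝ) {j k : Fin d} (hjk : j ≠ k)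
    (x : EuclideanSpace ℝ (Fin d)) :
    truncatedAngularProduct c j k (signFlip j x) = -truncatedAngularProduct c j k x := by
  simp only [truncatedAngularProduct, Set.indicator, Set.mem_ofPred_eq, norm_signFlip, angularPart]
  split_ifs
  · simp [signFlip, hjk.symm]
  · simp

theorem truncatedAngularProduct_coordPerm {d : ℕ} (c : ℝ) (j k : Fin d) (σ : Equiv.Perm (Fin d))
    (x : EuclideanSpace ℝ (Fin d)) :
    truncatedAngularProduct c j k (coordPerm σ x) = truncatedAngularProduct c (σ j) (σ k) x := by
  simp only [truncatedAngularProduct, Set.indicator, Set.mem_ofPred_eq, norm_coordPerm, angularPart]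
  simp [coordPerm]

/-- Only an inequality: for `c ≤ 0` the vector `0` is not cut off, and its angular part is `0`. -/
theorem sum_truncatedAngularProduct_le {d : ℕ} (c : ℝ) (x : EuclideanSpace ℝ (Fin d)) :
    ∑ j, truncatedAngularProduct c j j x ≤ {x | c ≤ ‖x‖ ^ 2}.indicator 1 x := by
  unfold truncatedAngularProduct Set.indicator
  split_ifs with h
  · have := norm_angularPart_le_one x
    calc ∑ j, angularPart x j * angularPart x j = ‖angularPart x‖ ^ 2 := by
          simp [EuclideanSpace.norm_sq_eq, ← sq]
      _ ≤ 1 := pow_le_one₀ (norm_nonneg _) this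
  · simp

/-! ### Second moments of the angular part under an invariant law -/

section Invariant

variable {d : ℕ} {ν : Measure (EuclideanSpace ℝ (Fin d))}

theorem HyperoctahedralInvariant.integral_truncatedAngularProduct_of_ne
    (hν : HyperoctahedralInvariant ν) (c : ℝ) {j k : Fin d} (hjk : j ≠ k) :
    ∫ x, truncatedAngularProduct c j k x ∂ν = 0 := by
  have h := integral_map (μ := ν) (hν.signFlip j).measurable.aemeasurable
    (measurable_truncatedAngularProduct c j k).aestronglyMeasurable
  rw [(hν.signFlip j).map_eq] at h
  simp only [truncatedAngularProduct_signFlip c hjk, integral_neg] at h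
  linarith

theorem HyperoctahedralInvariant.integral_truncatedAngularProduct_self_eq
    (hν : HyperoctahedralInvariant ν) (c : ℝ) (j k : Fin d) :
    ∫ x, truncatedAngularProduct c j j x ∂ν = ∫ x, truncatedAngularProduct c k k x ∂ν := by
  have h := integral_map (μ := ν) (hν.coordPerm (Equiv.swap j k)).measurable.aemeasurable
    (measurable_truncatedAngularProduct c j j).aestronglyMeasurable
  rw [(hν.coordPerm _).map_eq] at h
  simpa [truncatedAngularProduct_coordPerm] using h

theorem integral_truncatedAngularProduct_self_nonneg (c : ℝ) (j : Fin d) :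
    0 ≤ ∫ x, truncatedAngularProduct c j j x ∂ν :=
  integral_nonneg fun x => Set.indicator_nonneg (fun _ _ => mul_self_nonneg _) x

theorem HyperoctahedralInvariant.mul_integral_truncatedAngularProduct_self_le [IsFiniteMeasure ν]
    (hν : HyperoctahedralInvariant ν) (c : ℝ) (j : Fin d) :
    d * ∫ x, truncatedAngularProduct c j j x ∂ν ≤ ν.real {x | c ≤ ‖x‖ ^ 2} := by
  calc d * ∫ x, truncatedAngularProduct c j j x ∂ν
      = ∑ k : Fin d, ∫ x, truncatedAngularProduct c k k x ∂ν := by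
        simp [fun k => hν.integral_truncatedAngularProduct_self_eq c k j]
    _ = ∫ x, ∑ k : Fin d, truncatedAngularProduct c k k x ∂ν :=
        (integral_finsetSum _ fun k _ => integrable_truncatedAngularProduct ν c k k).symm
    _ ≤ ∫ x, {x | c ≤ ‖x‖ ^ 2}.indicator 1 x ∂ν :=
        integral_mono (integrable_finsetSum _ fun k _ => integrable_truncatedAngularProduct ν c k k)
          ((integrable_const 1).indicator (measurableSet_le_norm_sq c))
          (sum_truncatedAngularProduct_le c)
    _ = ν.real {x | c ≤ ‖x‖ ^ 2} := integral_indicator_one (measurableSet_le_norm_sq c)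

end Invariant

/-- The squared inner product of the angular parts, on the event that both norms are large. -/
theorem indicator_inner_angularPart_sq {Ω : Type*} {d : ℕ} (X₁ X₂ : Ω → EuclideanSpace ℝ (Fin d))
    (c : ℝ) (ω : Ω) :
    (largeNormsEvent X₁ X₂ c).indicator
        (fun ω => inner ℝ (angularPart (X₁ ω)) (angularPart (X₂ ω)) ^ 2) ω =
      ∑ j, ∑ k, truncatedAngularProduct c j k (X₁ ω) * truncatedAngularProduct c j k (X₂ ω) := by
  simp only [truncatedAngularProduct, Set.indicator, largeNormsEvent, Set.mem_ofPred_eq]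
  by_cases h₁ : c ≤ ‖X₁ ω‖ ^ 2 <;> by_cases h₂ : c ≤ ‖X₂ ω‖ ^ 2 <;> simp [h₁, h₂]
  rw [PiLp.inner_apply, sq, Finset.sum_mul_sum]
  refine Finset.sum_congr rfl fun j _ => Finset.sum_congr rfl fun k _ => ?_
  simp
  ring

/-! ### Two independent invariant vectors -/

section Independent

variable {Ω : Type*} [MeasurableSpace Ω] {P : Measure Ω} {d : ℕ}
  {X₁ X₂ : Ω → EuclideanSpace ℝ (Fin d)}

theorem measurableSet_largeNormsEvent (hX₁ : Measurable X₁) (hX₂ : Measurable X₂) (c : ℝ) :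
    MeasurableSet (largeNormsEvent X₁ X₂ c) :=
  (hX₁ (measurableSet_le_norm_sq c)).inter (hX₂ (measurableSet_le_norm_sq c))

theorem measure_largeNormsEvent (hX : IndepFun X₁ X₂ P) (c : ℝ) :
    P (largeNormsEvent X₁ X₂ c) = P {ω | c ≤ ‖X₁ ω‖ ^ 2} * P {ω | c ≤ ‖X₂ ω‖ ^ 2} :=
  hX.measure_inter_preimage_eq_mul _ _ (measurableSet_le_norm_sq c) (measurableSet_le_norm_sq c)

theorem measureReal_largeNormsEvent_inter_le [IsProbabilityMeasure P]
    (hX₁ : Measurable X₁) (hX₂ : Measurable X₂)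
    (hX : IndepFun X₁ X₂ P) (hν₁ : HyperoctahedralInvariant (P.map X₁))
    (hν₂ : HyperoctahedralInvariant (P.map X₂)) (c : ℝ) {ε : ℝ} (hε : 0 < ε) (hd : 0 < d) :
    P.real (largeNormsEvent X₁ X₂ c ∩
        {ω | ε < |inner ℝ (angularPart (X₁ ω)) (angularPart (X₂ ω))|}) ≤
      P.real (largeNormsEvent X₁ X₂ c) * ((ε ^ 2)⁻¹ * (d : ℝ)⁻¹) := by
  have := Measure.isProbabilityMeasure_map (μ := P) hX₁.aemeasurable
  have := Measure.isProbabilityMeasure_map (μ := P) hX₂.aemeasurable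
  set A := largeNormsEvent X₁ X₂ c
  set f : Ω → ℝ := A.indicator
    (fun ω => inner ℝ (angularPart (X₁ ω)) (angularPart (X₂ ω)) ^ 2) with hf
  have hf_eq : f = fun ω => ∑ j, ∑ k,
      truncatedAngularProduct c j k (X₁ ω) * truncatedAngularProduct c j k (X₂ ω) :=
    funext (indicator_inner_angularPart_sq X₁ X₂ c)
  have hint (j k : Fin d) : Integrable
      (fun ω => truncatedAngularProduct c j k (X₁ ω) * truncatedAngularProduct c j k (X₂ ω)) P := by
    refine .of_bound (((measurable_truncatedAngularProduct c j k).comp hX₁).mul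
      ((measurable_truncatedAngularProduct c j k).comp hX₂)).aestronglyMeasurable 1
      (.of_forall fun ω => ?_)
    rw [norm_mul]
    exact mul_le_one₀ (abs_truncatedAngularProduct_le_one c j k _) (norm_nonneg _)
      (abs_truncatedAngularProduct_le_one c j k _)
  have hf_int : Integrable f P := by
    rw [hf_eq]
    exact integrable_finsetSum _ fun j _ => integrable_finsetSum _ fun k _ => hint j k
  have hprod (j k : Fin d) :
      ∫ ω, truncatedAngularProduct c j k (X₁ ω) * truncatedAngularProduct c j k (X₂ ω) ∂P =
        (∫ x, truncatedAngularProduct c j k x ∂(P.map X₁)) *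
          ∫ x, truncatedAngularProduct c j k x ∂(P.map X₂) := by
    have hm := measurable_truncatedAngularProduct c j k
    rw [hX.integral_fun_comp_mul_comp hX₁.aemeasurable hX₂.aemeasurable
      hm.aestronglyMeasurable hm.aestronglyMeasurable,
      integral_map hX₁.aemeasurable hm.aestronglyMeasurable,
      integral_map hX₂.aemeasurable hm.aestronglyMeasurable]
  have hA : P.real A =
      (P.map X₁).real {x | c ≤ ‖x‖ ^ 2} * (P.map X₂).real {x | c ≤ ‖x‖ ^ 2} := by
    simp only [measureReal_def, Measure.map_apply hX₁ (measurableSet_le_norm_sq c),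
      Measure.map_apply hX₂ (measurableSet_le_norm_sq c), ← ENNReal.toReal_mul]
    exact congrArg _ (measure_largeNormsEvent hX c)
  have hd' : (0 : ℝ) < d := by exact_mod_cast hd
  have hfA : ∫ ω, f ω ∂P ≤ P.real A * (d : ℝ)⁻¹ := by
    have hdiag (j : Fin d) :
        ∑ k, ∫ ω, truncatedAngularProduct c j k (X₁ ω) * truncatedAngularProduct c j k (X₂ ω) ∂P ≤
          P.real A * (d : ℝ)⁻¹ * (d : ℝ)⁻¹ := by
      -- Off the diagonal it suffices that the factor coming from `X₁` vanishes.
      rw [Finset.sum_eq_single j (fun k _ hk => by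
        rw [hprod, hν₁.integral_truncatedAngularProduct_of_ne c hk.symm, zero_mul]) (by simp),
        hprod, hA, ← div_eq_mul_inv, ← div_eq_mul_inv, le_div_iff₀ hd', le_div_iff₀ hd']
      calc _ = (d * ∫ x, truncatedAngularProduct c j j x ∂(P.map X₁)) *
            (d * ∫ x, truncatedAngularProduct c j j x ∂(P.map X₂)) := by ring
        _ ≤ _ := mul_le_mul (hν₁.mul_integral_truncatedAngularProduct_self_le c j)
            (hν₂.mul_integral_truncatedAngularProduct_self_le c j)
            (mul_nonneg hd'.le (integral_truncatedAngularProduct_self_nonneg c j))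
            measureReal_nonneg
    rw [hf_eq, integral_finsetSum _ fun j _ => integrable_finsetSum _ fun k _ => hint j k]
    simp_rw [integral_finsetSum _ fun k _ => hint _ k]
    refine (Finset.sum_le_sum fun j _ => hdiag j).trans_eq ?_
    simp
    field_simp
  have hsub : A ∩ {ω | ε < |inner ℝ (angularPart (X₁ ω)) (angularPart (X₂ ω))|} ⊆
      {ω | ε ^ 2 ≤ f ω} := by
    rintro ω ⟨hωA, hω⟩
    simp only [Set.mem_ofPred_eq, hf, Set.indicator_of_mem hωA] at hω ⊢
    rw [← sq_abs (inner ℝ _ _)]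
    exact pow_le_pow_left₀ hε.le hω.le 2
  have hmarkov := mul_meas_ge_le_integral_of_nonneg (.of_forall fun ω =>
    Set.indicator_nonneg (fun _ _ => sq_nonneg _) ω) hf_int (ε ^ 2)
  calc _ ≤ P.real {ω | ε ^ 2 ≤ f ω} := measureReal_mono hsub
    _ = (ε ^ 2)⁻¹ * (ε ^ 2 * P.real {ω | ε ^ 2 ≤ f ω}) := by field_simp
    _ ≤ (ε ^ 2)⁻¹ * (P.real A * (d : ℝ)⁻¹) := 
        mul_le_mul_of_nonneg_left (hmarkov.trans hfA) (by positivity)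
    _ = _ := by ring

theorem cond_largeNormsEvent_le [IsProbabilityMeasure P]
    (hX₁ : Measurable X₁) (hX₂ : Measurable X₂)
    (hX : IndepFun X₁ X₂ P) (hν₁ : HyperoctahedralInvariant (P.map X₁))
    (hν₂ : HyperoctahedralInvariant (P.map X₂)) (c : ℝ) {ε : ℝ} (hε : 0 < ε) (hd : 0 < d) :
    ProbabilityTheory.cond P (largeNormsEvent X₁ X₂ c)
        {ω | ε < |inner ℝ (angularPart (X₁ ω)) (angularPart (X₂ ω))|} ≤
      ENNReal.ofReal ((ε ^ 2)⁻¹ * (d : ℝ)⁻¹) := by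
  have h := measureReal_largeNormsEvent_inter_le hX₁ hX₂ hX hν₁ hν₂ c hε hd
  rw [cond_apply (measurableSet_largeNormsEvent hX₁ hX₂ c)]
  rw [← ENNReal.ofReal_le_ofReal_iff (by positivity), ENNReal.ofReal_mul measureReal_nonneg,
    ofReal_measureReal, ofReal_measureReal] at h
  calc _ ≤ (P (largeNormsEvent X₁ X₂ c))⁻¹ *
        (P (largeNormsEvent X₁ X₂ c) * ENNReal.ofReal ((ε ^ 2)⁻¹ * (d : ℝ)⁻¹)) := by gcongr
    -- This also holds when the conditioning event is null, since `⊤ * 0 = 0`.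
    _ ≤ 1 * ENNReal.ofReal ((ε ^ 2)⁻¹ * (d : ℝ)⁻¹) := by
        rw [← mul_assoc]
        gcongr
        exact ENNReal.inv_mul_le_one _
    _ = _ := one_mul _

end Independent

/-! ### Invariance, independence and positivity for the heavy-tailed steps -/

theorem hyperoctahedralInvariant_map_pi {ι : Type*} [Fintype ι] [DecidableEq ι] (μ : Measure ℝ)
    [IsProbabilityMeasure μ] (hμ : MeasurePreserving (fun x : ℝ => -x) μ μ) (c : ℝ) :
    HyperoctahedralInvariant ((Measure.pi fun _ : ι => μ).map
      fun y => WithLp.toLp 2 fun j => c * y j) := by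
  have hT : Measurable fun y : ι → ℝ => (WithLp.toLp 2 fun j => c * y j : EuclideanSpace ℝ ι) := by
    fun_prop
  constructor
  · intro j
    have hm : Measurable (signFlip j : EuclideanSpace ℝ ι → EuclideanSpace ℝ ι) := by
      refine (PiLp.continuous_toLp 2 _).measurable.comp (measurable_pi_iff.2 fun i => ?_)
      split_ifs <;> fun_prop
    have hg : MeasurePreserving (fun (y : ι → ℝ) i => (if i = j then (fun x => -x) else id) (y i))
        (Measure.pi fun _ => μ) (Measure.pi fun _ => μ) :=
      measurePreserving_pi _ _ fun i => by
        split_ifs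
        exacts [hμ, .id μ]
    refine ⟨hm, ?_⟩
    -- The sign change is moved through the scaling map to the product measure, which it preserves.
    conv_rhs => rw [← hg.map_eq]
    rw [Measure.map_map hm hT, Measure.map_map hT hg.measurable]
    congr 1
    ext y i
    by_cases h : i = j <;> simp [signFlip, h]
  · intro σ
    have hm : Measurable (coordPerm σ : EuclideanSpace ℝ ι → EuclideanSpace ℝ ι) := by
      unfold coordPerm
      fun_prop
    have hg : MeasurePreserving (fun (y : ι → ℝ) i => y (σ i))
        (Measure.pi fun _ => μ) (Measure.pi fun _ => μ) :=
      -- Reindexing along `e` sends `y` to `y ∘ e.symm`, hence `σ.symm`.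
      measurePreserving_arrowCongr' (fun _ : ι => μ) (fun _ : ι => μ) σ.symm
        (MeasurableEquiv.refl ℝ) fun _ => .id μ
    refine ⟨hm, ?_⟩
    conv_rhs => rw [← hg.map_eq]
    rw [Measure.map_map hm hT, Measure.map_map hT hg.measurable]
    rfl

/-- Equivalence to a nonvanishing function forces nonzero tails at arbitrarily large levels;
monotonicity covers every `t`. -/
theorem measure_lt_sq_pos {Ω : Type*} [MeasurableSpace Ω] {P : Measure Ω} [IsFiniteMeasure P]
    {α : ℝ} {ξ : Ω → ℝ}
    (htail : (fun t : ℝ => P.real {ω | t < ξ ω ^ 2}) ~[atTop] (fun t : ℝ => t ^ (-α))) (t : ℝ) :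
    0 < P {ω | t < ξ ω ^ 2} := by
  have hpos : ∀ᶠ u : ℝ in atTop, u ^ (-α) ≠ 0 :=
    (eventually_gt_atTop 0).mono fun u hu => (Real.rpow_pos_of_pos hu _).ne'
  obtain ⟨u, hu, hut⟩ := ((((isEquivalent_iff_tendsto_one hpos).1 htail).eventually_ne one_ne_zero).and
    (eventually_ge_atTop t)).exists
  have hu' : P {ω | u < ξ ω ^ 2} ≠ 0 := fun h => hu (by simp [measureReal_def, h])
  exact (pos_iff_ne_zero.2 hu').trans_le (measure_mono fun ω hω => hut.trans_lt hω)

theorem measurable_heavyTailedStep {Ω : Type*} [MeasurableSpace Ω] (α : ℝ) {Ξ : ℕ → ℕ → Ω → ℝ}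
    (hΞ : ∀ i j, Measurable (Ξ i j)) (d i : ℕ) : Measurable (heavyTailedStep α Ξ d i) := by
  unfold heavyTailedStep
  fun_prop

/-- Distinct steps are functions of disjoint finite blocks of the array. -/
theorem indepFun_heavyTailedStep {Ω : Type*} [MeasurableSpace Ω] {P : Measure Ω} (α : ℝ)
    {Ξ : ℕ → ℕ → Ω → ℝ} (hΞ : ∀ i j, Measurable (Ξ i j))
    (hindep : iIndepFun (fun p : ℕ × ℕ => Ξ p.1 p.2) P) (d : ℕ) {i i' : ℕ} (hi : i ≠ i') :
    IndepFun (heavyTailedStep α Ξ d i) (heavyTailedStep α Ξ d i') P := by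
  let S (i : ℕ) : Finset (ℕ × ℕ) := {i} ×ˢ Finset.range d
  have hS : Disjoint (S i) (S i') := by
    refine Finset.disjoint_left.2 fun p hp hp' => hi ?_
    simp only [S, Finset.mem_product, Finset.mem_singleton] at hp hp'
    exact hp.1.symm.trans hp'.1
  let φ (i : ℕ) (y : S i → ℝ) : EuclideanSpace ℝ (Fin d) :=
    WithLp.toLp 2 fun j => (d : ℝ) ^ (-(1 / (2 * α))) * y ⟨(i, j), by simp [S]⟩
  have hφ (i : ℕ) : Measurable (φ i) := by fun_prop
  exact (hindep.indepFun_finset (S i) (S i') hS fun p => hΞ p.1 p.2).comp (hφ i) (hφ i')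

theorem map_heavyTailedStep {Ω : Type*} [MeasurableSpace Ω] {P : Measure Ω}
    [IsProbabilityMeasure P] (α : ℝ) {Ξ : ℕ → ℕ → Ω → ℝ} (hΞ : ∀ i j, Measurable (Ξ i j))
    (hindep : iIndepFun (fun p : ℕ × ℕ => Ξ p.1 p.2) P) {μ : Measure ℝ}
    (hμ : ∀ i j, P.map (Ξ i j) = μ) (d i : ℕ) :
    P.map (heavyTailedStep α Ξ d i) = (Measure.pi fun _ : Fin d => μ).map
      fun y => WithLp.toLp 2 fun j => (d : ℝ) ^ (-(1 / (2 * α))) * y j := by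
  have hinj : Function.Injective fun j : Fin d => (i, (j : ℕ)) := fun j k h => by
    simpa [Fin.ext_iff] using h
  have h := iIndepFun.map_fun_eq_pi_map (f := fun j : Fin d => Ξ i j)
    (fun j => (hΞ i j).aemeasurable) (hindep.precomp hinj)
  simp only [hμ] at h
  rw [← h, Measure.map_map (by fun_prop) (by fun_prop)]
  rfl

/-- A single large coordinate already makes the norm large. -/
theorem measure_le_norm_heavyTailedStep_sq_pos {Ω : Type*} [MeasurableSpace Ω] {P : Measure Ω}
    (α : ℝ) {Ξ : ℕ → ℕ → Ω → ℝ} {d : ℕ} (hd : 0 < d) {i : ℕ}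
    (hpos : ∀ t, 0 < P {ω | t < Ξ i 0 ω ^ 2}) (c : ℝ) :
    0 < P {ω | c ≤ ‖heavyTailedStep α Ξ d i ω‖ ^ 2} := by
  have hd' : (0 : ℝ) < d := by exact_mod_cast hd
  set b : ℝ := (d : ℝ) ^ (-(1 / (2 * α)))
  have hb : 0 < b := Real.rpow_pos_of_pos hd' _
  refine (hpos (c / b ^ 2)).trans_le (measure_mono fun ω hω => ?_)
  rw [Set.mem_ofPred_eq, div_lt_iff₀ (by positivity)] at hω
  have h := PiLp.norm_apply_le (heavyTailedStep α Ξ d i ω) ⟨0, hd⟩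
  calc c ≤ ‖heavyTailedStep α Ξ d i ω ⟨0, hd⟩‖ ^ 2 := by
        simp only [heavyTailedStep, Real.norm_eq_abs, sq_abs]
        linarith [mul_pow b (Ξ i 0 ω) 2]
    _ ≤ _ := pow_le_pow_left₀ (norm_nonneg _) h 2

theorem mainTheorem9
    {Ω₀ : Type*} [MeasurableSpace Ω₀] (P₀ : Measure Ω₀) [IsProbabilityMeasure P₀]
    {Ω : Type*} [MeasurableSpace Ω] (P : Measure Ω) [IsProbabilityMeasure P]
    (α : ℝ) (hα₀ : 0 < α) (hα₁ : α < 1)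
    -- a symmetric random variable with `P(ξ² > t) ∼ t^{-α}`
    (ξ : Ω₀ → ℝ) (hξ : Measurable ξ)
    (hsymm : IdentDistrib ξ (fun ω => -ξ ω) P₀ P₀)
    (htail : (fun t : ℝ => P₀.real {ω | t < ξ ω ^ 2}) ~[atTop] (fun t : ℝ => t ^ (-α)))
    -- an array of independent copies of it
    (Ξ : ℕ → ℕ → Ω → ℝ) (hΞ : ∀ i j, Measurable (Ξ i j))
    (hcopy : ∀ i j, IdentDistrib (Ξ i j) ξ P P₀)
    (hindep : iIndepFun (fun p : ℕ × ℕ => Ξ p.1 p.2) P)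
    -- an arbitrary sequence `n = n(d) → ∞`
    (n : ℕ → ℕ) (hn : Tendsto n atTop atTop) :
    AsymptoticallyOrthogonal P (heavyTailedStep α Ξ) (fun k : ℕ => (k : ℝ) ^ (1 / α)) n := by
  have := Measure.isProbabilityMeasure_map (μ := P₀) hξ.aemeasurable
  have hneg : MeasurePreserving (fun x : ℝ => -x) (P₀.map ξ) (P₀.map ξ) :=
    ⟨measurable_neg, by
      rw [Measure.map_map measurable_neg hξ]
      exact hsymm.map_eq.symm⟩
  have hinv (d i : ℕ) : HyperoctahedralInvariant (P.map (heavyTailedStep α Ξ d i)) := by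
    rw [map_heavyTailedStep α hΞ hindep (fun i j => (hcopy i j).map_eq)]
    exact hyperoctahedralInvariant_map_pi _ hneg _
  have hindep' (d : ℕ) := indepFun_heavyTailedStep α hΞ hindep d zero_ne_one
  have hmeas := measurable_heavyTailedStep α hΞ
  have hpos (i : ℕ) (t : ℝ) : 0 < P {ω | t < Ξ i 0 ω ^ 2} := by
    have hs : MeasurableSet {x : ℝ | t < x ^ 2} := measurableSet_lt measurable_const (by fun_prop)
    exact (measure_lt_sq_pos htail t).trans_eq ((hcopy i 0).measure_mem_eq hs).symm
  intro s _ ε hε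
  constructor
  · filter_upwards [eventually_gt_atTop 0] with d hd
    rw [measure_largeNormsEvent (hindep' d)]
    exact ENNReal.mul_pos (measure_le_norm_heavyTailedStep_sq_pos α hd (hpos 0) _).ne'
      (measure_le_norm_heavyTailedStep_sq_pos α hd (hpos 1) _).ne'
  · have hlim : Tendsto (fun d : ℕ => ENNReal.ofReal ((ε ^ 2)⁻¹ * (d : ℝ)⁻¹)) atTop (𝓝 0) := by
      have := (tendsto_inv_atTop_nhds_zero_nat (𝕜 := ℝ)).const_mul (ε ^ 2)⁻¹
      simpa using ENNReal.tendsto_ofReal this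
    refine tendsto_of_tendsto_of_tendsto_of_le_of_le' tendsto_const_nhds hlim
      (.of_forall fun _ => zero_le) ?_
    filter_upwards [eventually_gt_atTop 0] with d hd
    exact cond_largeNormsEvent_le (hmeas d 0) (hmeas d 1) (hindep' d) (hinv d 0) (hinv d 1) _ hε hd
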